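/- A \emph{proximity} on a set $X$ is a binary relation $\delta$ on the subsets of $X$ such that, for all $A,B,C\subseteq X$: (1) $A\,\delta\,B$ implies $B\,\delta\,A$; (2) $A\,\delta\,B$ implies $A,B\neq\emptyset$; (3) $A\cap B\neq\emptyset$ implies $A\,\delta\,B$; (4) $A\,\delta\,(B\cup C)$ if and only if $A\,\delta\,B$ or $A\,\delta\,C$; (5) if not $A\,\delta\,B$, then there is $E\subseteq X$ such that neither $A\,\delta\,E$ nor $(X\setminus E)\,\delta\,B$. It is \emph{separated} if $\{x\}\,\delta\,\{y\}\iff x=y$. It induces the topology in which $A$ is closed if and only if $A$ contains every $x$ with $A\,\delta\,\{x\}$. The \emph{coproduct} of proximity spaces $(X_\alpha,\delta_\alpha)_{\alpha\in I}$ is the disjoint union $\coprod_\alpha X_\alpha$ with the proximity $\delta$ given by $A\,\delta\,B$ if and only if $(A\cap X_\alpha)\,\delta_\alpha\,(B\cap X_\alpha)$ for some $\alpha$. A \emph{cluster} in a separated proximity space $(X,\delta)$ is a nonempty collection $\sigma$ of subsets of $X$ such that: $A\,\delta\,B$ for all $A,B\in\sigma$; if $C\,\delta\,A$ for all $A\in\sigma$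 then $C\in\sigma$; and if $A\cup B\in\sigma$ then $A\in\sigma$ or $B\in\sigma$. The \emph{Smirnov compactification} of $(X,\delta)$ is the set $\mathfrak X$ of all clusters in $X$ with the proximity $\delta^*$ in which $\mathcal A\,\delta^*\,\mathcal B$ if and only if $A\,\delta\,B$ for all $A,B\subseteq X$ such that $A$ belongs to every $\sigma\in\mathcal A$ and $B$ belongs to every $\sigma\in\mathcal B$. It carries the topology induced by $\delta^*$. The \emph{multiplicity} of a finite cover is the smallest $d$ such that every point lies in at most $d$ of its members. For a nonempty topological space $X$, the \emph{covering dimension} $\dim X\in\{0,1,2,\dots\}\cup\{\infty\}$ is the smallest $n$ such that every finite open cover of $X$ has a finite open refinement (again a cover) of multiplicity at most $n+1$, and $\infty$ if there is no such $n$. A \emph{$\delta$-covering} of $(X,\delta)$ is a finite collection $A_1,\dots,A_k\subseteq X$ for which there are $B_1,\dots,B_k\subseteq X$ with $\bigcup_i B_i=X$ and not $B_i\,\delta\,(X\setminus A_i)$ for every $i$. For a nonempty proximity space $(X,\delta)$, the \emph{proximity dimension} $\delta d(X)\in\{0,1,2,\dots\}\cup\{\infty\}$ is the smallest $n$ such that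 every $\delta$-covering of $X$ has a refinement that is a $\delta$-covering of multiplicity at most $n+1$, and $\infty$ if there is no such $n$. \textbf{Theorem.} Let $(X_\alpha,\delta_\alpha)_{\alpha\in I}$ be a family of nonempty separated proximity spaces indexed by a nonempty set $I$ of arbitrary cardinality. Let $(\coprod_\alpha X_\alpha,\delta)$ be its coproduct and $(\overline{\coprod_\alpha X_\alpha},\delta^*)$ the Smirnov compactification of this coproduct. For each $\alpha$ let $(\mathfrak X_\alpha,\delta_\alpha^*)$ be the Smirnov compactification of $(X_\alpha,\delta_\alpha)$, and let $(\coprod_\alpha\mathfrak X_\alpha,\delta_1)$ be the coproduct of these Smirnov compactifications. Then $$\delta d\Big(\coprod_\alpha X_\alpha\Big)=\delta_1 d\Big(\coprod_\alpha\mathfrak X_\alpha\Big)=\delta^* d\Big(\overline{\coprod_\alpha X_\alpha}\Big)=\dim\Big(\overline{\coprod_\alpha X_\alpha}\Big)=\sup_\alpha\dim(\mathfrak X_\alpha)=\sup_\alpha\delta_\alpha d(X_\alpha)=\sup_\alpha\delta_\alpha^* d(\mathfrak X_\alpha),$$ where all these values lie in $\{0,1,2,\dots\}\cup\{\infty\}$.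 -/

import Mathlib

universe u v

/-- A proximity on a set `X`: a closeness relation on subsets satisfying the five Efremovič
axioms. -/
structure Proximity (X : Type u) where
  close : Set X → Set X → Prop
  symm : ∀ A B, close A B → close B A
  nonempty_of_close : ∀ A B, close A B → A.Nonempty ∧ B.Nonempty
  close_of_inter : ∀ A B, (A ∩ B).Nonempty → close A B
  close_union : ∀ A B C, close A (B ∪ C) ↔ close A B ∨ close A C
  exists_separator : ∀ A B, ¬ close A B → ∃ E : Set X, ¬ close A E ∧ ¬ close Eᶜ B

namespace Proximity

/-- A proximity is separated if two points are close exactly when they are equal. -/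
def IsSeparated {X : Type u} (δ : Proximity X) : Prop :=
  ∀ x y : X, δ.close {x} {y} ↔ x = y

theorem close_mono_right {X : Type u} (δ : Proximity X) {A B C : Set X} (h : B ⊆ C)
    (hAB : δ.close A B) : δ.close A C := by
  have := (δ.close_union A B C).2 (Or.inl hAB)
  rwa [Set.union_eq_self_of_subset_left h] at this

theorem close_mono_left {X : Type u} (δ : Proximity X) {A B C : Set X} (h : A ⊆ C)
    (hAB : δ.close A B) : δ.close C B :=
  δ.symm _ _ (δ.close_mono_right h (δ.symm _ _ hAB))

theorem union_close {X : Type u} (δ : Proximity X) (A B C : Set X) :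
    δ.close (A ∪ B) C ↔ δ.close A C ∨ δ.close B C := by
  constructor
  · intro h
    exact ((δ.close_union C A B).1 (δ.symm _ _ h)).imp (δ.symm _ _) (δ.symm _ _)
  · intro h
    exact δ.symm _ _ ((δ.close_union C A B).2 (h.imp (δ.symm _ _) (δ.symm _ _)))

/-- The topology induced by a proximity: `A` is closed iff it contains every point close to it. -/
abbrev topology {X : Type u} (δ : Proximity X) : TopologicalSpace X :=
  TopologicalSpace.ofClosed {A | ∀ x, δ.close A {x} → x ∈ A}
    (fun _ h => absurd (δ.nonempty_of_close _ _ h).1 Set.not_nonempty_empty)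
    (fun _ h𝒜 x hx _ hA => h𝒜 hA x (δ.close_mono_left (Set.sInter_subset_of_mem hA) hx))
    (fun A hA B hB x hx => ((δ.union_close A B {x}).1 hx).imp (hA x) (hB x))

/-- The coproduct proximity on the disjoint union: `A` and `B` are close iff their traces on some
summand are close. -/
def coproduct {I : Type u} {X : I → Type v} (δ : ∀ α, Proximity (X α)) :
    Proximity (Σ α, X α) where
  close A B := ∃ α, (δ α).close (Sigma.mk α ⁻¹' A) (Sigma.mk α ⁻¹' B)
  symm := fun _ _ ⟨α, h⟩ => ⟨α, (δ α).symm _ _ h⟩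
  nonempty_of_close := fun _ _ ⟨α, h⟩ => by
    obtain ⟨⟨x, hx⟩, ⟨y, hy⟩⟩ := (δ α).nonempty_of_close _ _ h
    exact ⟨⟨_, hx⟩, ⟨_, hy⟩⟩
  close_of_inter := fun _ _ ⟨⟨α, x⟩, h⟩ => ⟨α, (δ α).close_of_inter _ _ ⟨x, h⟩⟩
  close_union := fun A B C => by
    simp only [Set.preimage_union, (δ _).close_union, exists_or]
  exists_separator := fun A B h => by
    have h' : ∀ α, ¬ (δ α).close (Sigma.mk α ⁻¹' A) (Sigma.mk α ⁻¹' B) := fun α hα => h ⟨α, hα⟩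
    choose E hE₁ hE₂ using fun α => (δ α).exists_separator _ _ (h' α)
    exact ⟨{p | p.2 ∈ E p.1}, fun ⟨α, hα⟩ => hE₁ α hα, fun ⟨α, hα⟩ => hE₂ α hα⟩

/-- A cluster in a proximity space. -/
@[ext]
structure Cluster {X : Type u} (δ : Proximity X) where
  sets : Set (Set X)
  nonempty : sets.Nonempty
  close_of_mem : ∀ A ∈ sets, ∀ B ∈ sets, δ.close A B
  mem_of_close : ∀ C, (∀ A ∈ sets, δ.close C A) → C ∈ sets
  mem_or_mem : ∀ A B, A ∪ B ∈ sets → A ∈ sets ∨ B ∈ sets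

theorem Cluster.univ_mem {X : Type u} {δ : Proximity X} (σ : δ.Cluster) : Set.univ ∈ σ.sets :=
  σ.mem_of_close _ fun A hA => δ.close_of_inter _ _ (by
    simpa using (δ.nonempty_of_close _ _ (σ.close_of_mem A hA A hA)).1)

theorem Cluster.mem_of_superset {X : Type u} {δ : Proximity X} (σ : δ.Cluster) {A B : Set X}
    (hA : A ∈ σ.sets) (h : A ⊆ B) : B ∈ σ.sets :=
  σ.mem_of_close _ fun C hC => δ.close_mono_left h (σ.close_of_mem A hA C hC)

theorem Cluster.mem_or_compl_mem {X : Type u} {δ : Proximity X} (σ : δ.Cluster) (A : Set X) :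
    A ∈ σ.sets ∨ Aᶜ ∈ σ.sets :=
  σ.mem_or_mem _ _ (by rw [Set.union_compl_self]; exact σ.univ_mem)

/-- `C` absorbs a set `𝒜` of clusters if it belongs to each of them. -/
def Absorbs {X : Type u} (δ : Proximity X) (C : Set X) (𝒜 : Set δ.Cluster) : Prop :=
  ∀ σ ∈ 𝒜, C ∈ σ.sets

/-- The proximity of the Smirnov compactification, whose points are the clusters of `δ`. -/
def smirnov {X : Type u} (δ : Proximity X) : Proximity δ.Cluster where
  close 𝒜 ℬ := ∀ A B : Set X, δ.Absorbs A 𝒜 → δ.Absorbs B ℬ → δ.close A B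
  symm := fun _ _ h A B hA hB => δ.symm _ _ (h B A hB hA)
  nonempty_of_close := fun 𝒜 ℬ h => by
    constructor
    · by_contra hne
      rw [Set.not_nonempty_iff_eq_empty] at hne
      subst hne
      exact Set.not_nonempty_empty (δ.nonempty_of_close _ _
        (h ∅ Set.univ (fun σ hσ => hσ.elim) (fun σ _ => σ.univ_mem))).1
    · by_contra hne
      rw [Set.not_nonempty_iff_eq_empty] at hne
      subst hne
      exact Set.not_nonempty_empty (δ.nonempty_of_close _ _
        (h Set.univ ∅ (fun σ _ => σ.univ_mem) (fun σ hσ => hσ.elim))).2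
  close_of_inter := fun _ _ ⟨σ, h𝒜, hℬ⟩ A B hA hB =>
    σ.close_of_mem A (hA σ h𝒜) B (hB σ hℬ)
  close_union := fun 𝒜 ℬ 𝒞 => by
    constructor
    · intro h
      by_contra hcon
      push Not at hcon
      obtain ⟨⟨A₁, B, hA₁, hB, hAB⟩, ⟨A₂, C, hA₂, hC, hAC⟩⟩ := hcon
      obtain ⟨E₁, hE₁, hE₁'⟩ := δ.exists_separator _ _ hAB
      obtain ⟨E₂, hE₂, hE₂'⟩ := δ.exists_separator _ _ hAC
      have habs : δ.Absorbs (E₁ ∪ E₂)ᶜ 𝒜 := by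
        intro σ hσ
        refine (σ.mem_or_compl_mem (E₁ ∪ E₂)).resolve_left fun hmem => ?_
        rcases σ.mem_or_mem _ _ hmem with h₁ | h₂
        · exact hE₁ (σ.close_of_mem _ (hA₁ σ hσ) _ h₁)
        · exact hE₂ (σ.close_of_mem _ (hA₂ σ hσ) _ h₂)
      have habs' : δ.Absorbs (B ∪ C) (ℬ ∪ 𝒞) := by
        rintro σ (hσ | hσ)
        · exact σ.mem_of_superset (hB σ hσ) Set.subset_union_left
        · exact σ.mem_of_superset (hC σ hσ) Set.subset_union_right
      rcases (δ.close_union _ _ _).1 (h _ _ habs habs') with h' | h'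
      · exact hE₁' (δ.close_mono_left (Set.compl_subset_compl.2 Set.subset_union_left) h')
      · exact hE₂' (δ.close_mono_left (Set.compl_subset_compl.2 Set.subset_union_right) h')
    · rintro (h | h) A B hA hB
      · exact h A B hA fun σ hσ => hB σ (Or.inl hσ)
      · exact h A B hA fun σ hσ => hB σ (Or.inr hσ)
  exists_separator := fun 𝒜 ℬ h => by
    push Not at h
    obtain ⟨A, B, hA, hB, hAB⟩ := h
    obtain ⟨E, hE, hE'⟩ := δ.exists_separator _ _ hAB
    exact ⟨{σ | E ∈ σ.sets}, fun h => hE (h A E hA fun σ hσ => hσ),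
      fun h => hE' (h Eᶜ B (fun σ hσ => (σ.mem_or_compl_mem E).resolve_left hσ) hB)⟩

end Proximity

/-- The multiplicity of a family of subsets of `X`: the supremum over the points `x` of the number
of members that contain `x`. -/
noncomputable def coverMultiplicity {X : Type u} {k : ℕ} (A : Fin k → Set X) : ℕ∞ :=
  ⨆ x : X, {i | x ∈ A i}.encard

/-- `V` refines `U`: each member of `V` lies in some member of `U`. -/
def FamilyRefines {X : Type u} {m k : ℕ} (V : Fin m → Set X) (U : Fin k → Set X) : Prop :=
  ∀ j, ∃ i, V j ⊆ U i

/-- A finite open cover of the topological space `(X, t)`. -/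
def IsFiniteOpenCover {X : Type u} (t : TopologicalSpace X) {k : ℕ} (U : Fin k → Set X) : Prop :=
  (∀ i, @IsOpen X t (U i)) ∧ ⋃ i, U i = Set.univ

/-- Each finite open cover has a finite open refinement of multiplicity at most `n + 1`. -/
def CoveringDimLE {X : Type u} (t : TopologicalSpace X) (n : ℕ) : Prop :=
  ∀ (k : ℕ) (U : Fin k → Set X), IsFiniteOpenCover t U →
    ∃ (m : ℕ) (V : Fin m → Set X), IsFiniteOpenCover t V ∧ FamilyRefines V U ∧
      coverMultiplicity V ≤ n + 1

/-- The covering dimension of a nonempty topological space: the least `n` with `CoveringDimLE t n`,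
and `⊤` (infinity) if there is none. -/
noncomputable def coveringDim {X : Type u} (t : TopologicalSpace X) : ℕ∞ :=
  ⨅ (n : ℕ) (_ : CoveringDimLE t n), (n : ℕ∞)

namespace Proximity

/-- A `δ`-covering: a finite family `A` admitting a cover `B` of `X` with `B i ≪ A i`, that is,
`B i` is not close to the complement of `A i`. -/
def IsCovering {X : Type u} (δ : Proximity X) {k : ℕ} (A : Fin k → Set X) : Prop :=
  ∃ B : Fin k → Set X, ⋃ i, B i = Set.univ ∧ ∀ i, ¬ δ.close (B i) (A i)ᶜ

/-- Each `δ`-covering has a refinement that is a `δ`-covering of multiplicity at most `n + 1`. -/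
def DimLE {X : Type u} (δ : Proximity X) (n : ℕ) : Prop :=
  ∀ (k : ℕ) (U : Fin k → Set X), δ.IsCovering U →
    ∃ (m : ℕ) (V : Fin m → Set X), δ.IsCovering V ∧ FamilyRefines V U ∧
      coverMultiplicity V ≤ n + 1

/-- The proximity dimension of a nonempty proximity space: the least `n` with `δ.DimLE n`, and `⊤`
(infinity) if there is none. -/
noncomputable def dim {X : Type u} (δ : Proximity X) : ℕ∞ :=
  ⨅ (n : ℕ) (_ : δ.DimLE n), (n : ℕ∞)

end Proximity

/-! All seven values agree because of three facts about the proximity dimension. In a compact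
proximity space it equals the covering dimension (`coveringDim_eq_dim`): disjoint closed sets are
far, so δ-coverings and finite open covers refine each other without raising multiplicity. This
applies to Smirnov compactifications by `compactSpace_smirnov`. It does not change under Smirnov
compactification (`dim_smirnov`): coverings restrict to `X` along point clusters and extend back by
`smirnovExtension`, and neither operation raises multiplicity. On a coproduct it is the supremum
over the summands (`dim_coproduct`). The index set may be infinite, so refinements chosen summand by
summand could have unbounded length; taking them indexed like the given covering lets them be glued
into a finite family. -/

namespace Proximity

/-! ### Closeness, adherence and the induced topology -/

section Basic

variable {X : Type u} (δ : Proximity X)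

theorem iUnion_close {ι : Type*} [Finite ι] {B : ι → Set X} {C : Set X}
    (h : δ.close (⋃ i, B i) C) : ∃ i, δ.close (B i) C := by
  have key : ∀ s : Set ι, s.Finite → δ.close (⋃ i ∈ s, B i) C → ∃ i, δ.close (B i) C := by
    intro s hs
    induction s, hs using Set.Finite.induction_on with
    | empty =>
      intro h
      simp only [Set.mem_empty_iff_false, Set.iUnion_of_empty, Set.iUnion_empty] at h
      exact absurd (δ.nonempty_of_close _ _ h).1 Set.not_nonempty_empty
    | insert _ _ ih =>
      intro h
      rw [Set.biUnion_insert] at h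
      exact ((δ.union_close _ _ _).1 h).elim (fun h => ⟨_, h⟩) ih
  exact key Set.univ Set.finite_univ (by simpa using h)

/-- The points close to a set. -/
def adherence (A : Set X) : Set X := {x | δ.close A {x}}

theorem subset_adherence (A : Set X) : A ⊆ δ.adherence A :=
  fun x hx => δ.close_of_inter _ _ ⟨x, hx, rfl⟩

/-- If `E` separates `A` from `B`, then `E` contains every point close to `B`, since `Eᶜ` is far
from `B`. -/
theorem close_of_adherence_right {A B : Set X} (h : δ.close A (δ.adherence B)) :
    δ.close A B := by
  by_contra hAB
  obtain ⟨E, hE, hE'⟩ := δ.exists_separator _ _ hAB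
  refine hE (δ.close_mono_right (fun x hx => ?_) h)
  by_contra hxE
  exact hE' (δ.close_mono_left (Set.singleton_subset_iff.2 hxE) (δ.symm _ _ hx))

theorem close_of_adherence {A B : Set X} (h : δ.close (δ.adherence A) (δ.adherence B)) :
    δ.close A B :=
  δ.symm _ _ (δ.close_of_adherence_right (δ.symm _ _ (δ.close_of_adherence_right h)))

theorem isClosed_iff {A : Set X} : @IsClosed X δ.topology A ↔ δ.adherence A ⊆ A := by
  let _ := δ.topology
  rw [← isOpen_compl_iff]
  change Aᶜᶜ ∈ {A | ∀ x, δ.close A {x} → x ∈ A} ↔ _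
  rw [compl_compl]
  exact Iff.rfl

theorem isClosed_adherence (A : Set X) : @IsClosed X δ.topology (δ.adherence A) :=
  δ.isClosed_iff.2 fun _ hx => δ.symm _ _ (δ.close_of_adherence_right (δ.symm _ _ hx))

theorem subset_interior_of_not_close {A B : Set X} (h : ¬ δ.close B Aᶜ) :
    B ⊆ @interior X δ.topology A := by
  let _ := δ.topology
  have hsub : (δ.adherence Aᶜ)ᶜ ⊆ A := Set.compl_subset_comm.1 (δ.subset_adherence Aᶜ)
  refine fun x hx => interior_maximal hsub (δ.isClosed_adherence _).isOpen_compl fun hx' => ?_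
  exact h (δ.close_mono_left (Set.singleton_subset_iff.2 hx) (δ.symm _ _ hx'))

/-- Each point of `A` is far from the closed set `B`, so a separator gives it a neighbourhood far
from `B`. Finitely many of these cover `A`, and closeness distributes over finite unions. -/
theorem not_close_of_disjoint_closed (hc : @CompactSpace X δ.topology) {A B : Set X}
    (hA : @IsClosed X δ.topology A) (hB : @IsClosed X δ.topology B) (hAB : Disjoint A B) :
    ¬ δ.close A B := by
  let _ := δ.topology
  have hsep : ∀ x : A, ∃ E : Set X, ¬ δ.close {x.1} E ∧ ¬ δ.close Eᶜ B := fun x =>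
    δ.exists_separator _ _ fun h =>
      Set.disjoint_left.1 hAB x.2 (δ.isClosed_iff.1 hB (δ.symm _ _ h))
  choose E hE hE' using hsep
  obtain ⟨t, ht⟩ := hA.isCompact.elim_finite_subcover (fun x : A => interior (E x)ᶜ)
    (fun _ => isOpen_interior) fun x hx => Set.mem_iUnion.2 ⟨⟨x, hx⟩,
      δ.subset_interior_of_not_close (B := {x}) (by rw [compl_compl]; exact hE ⟨x, hx⟩) rfl⟩
  intro h
  have hsub : A ⊆ ⋃ x : t, (E x.1)ᶜ := fun x hx => by
    obtain ⟨i, hi, hxi⟩ := Set.mem_iUnion₂.1 (ht hx)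
    exact Set.mem_iUnion.2 ⟨⟨i, hi⟩, interior_subset hxi⟩
  obtain ⟨i, hi⟩ := δ.iUnion_close (δ.close_mono_left hsub h)
  exact hE' _ hi

theorem normalSpace_of_compactSpace (hc : @CompactSpace X δ.topology) :
    @NormalSpace X δ.topology := by
  let _ := δ.topology
  refine ⟨fun A B hA hB hAB => ?_⟩
  obtain ⟨E, hE, hE'⟩ := δ.exists_separator _ _ (δ.not_close_of_disjoint_closed hc hA hB hAB)
  refine ⟨interior Eᶜ, interior E, isOpen_interior, isOpen_interior,
    δ.subset_interior_of_not_close (by rwa [compl_compl]),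
    δ.subset_interior_of_not_close fun h => hE' (δ.symm _ _ h), ?_⟩
  exact disjoint_compl_left.mono interior_subset interior_subset

end Basic

/-! ### Proximity dimension: compact spaces and coproducts -/

section Dimension

theorem coverMultiplicity_le_iff {X : Type u} {k : ℕ} {A : Fin k → Set X} {c : ℕ∞} :
    coverMultiplicity A ≤ c ↔ ∀ x, {i | x ∈ A i}.encard ≤ c :=
  iSup_le_iff

theorem coverMultiplicity_mono {X : Type u} {k : ℕ} {A B : Fin k → Set X}
    (h : ∀ i, A i ⊆ B i) : coverMultiplicity A ≤ coverMultiplicity B :=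
  iSup_mono fun _ => Set.encard_le_encard fun i hi => h i hi

theorem iInf_natCast_le_iff {P : ℕ → Prop} (hP : ∀ m n, m ≤ n → P m → P n) (n : ℕ) :
    ⨅ (m : ℕ) (_ : P m), (m : ℕ∞) ≤ n ↔ P n := by
  refine ⟨fun h => ?_, fun h => iInf₂_le n h⟩
  by_contra hn
  have hlt : ((n + 1 : ℕ) : ℕ∞) ≤ ⨅ (m : ℕ) (_ : P m), (m : ℕ∞) := by
    refine le_iInf₂ fun m hm => Nat.cast_le.2 ?_
    by_contra hmn
    exact hn (hP m n (by omega) hm)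
  have := Nat.cast_le.1 (hlt.trans h)
  omega

theorem dim_le_iff {X : Type u} (δ : Proximity X) (n : ℕ) : δ.dim ≤ n ↔ δ.DimLE n := by
  refine iInf_natCast_le_iff (fun m n hmn h k U hU => ?_) n
  obtain ⟨l, V, hV, hVU, hm⟩ := h k U hU
  exact ⟨l, V, hV, hVU, hm.trans (by gcongr)⟩

/-- The shrinking lemma for normal spaces makes every finite open cover a δ-covering; conversely the
interiors of the members of a δ-covering still cover. -/
theorem coveringDim_eq_dim {X : Type u} (δ : Proximity X)
    (hc : @CompactSpace X δ.topology) : coveringDim δ.topology = δ.dim := by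
  let _ := δ.topology
  have := δ.normalSpace_of_compactSpace hc
  have hcov : ∀ {k : ℕ} {U : Fin k → Set X}, IsFiniteOpenCover δ.topology U →
      δ.IsCovering U := by
    rintro k U ⟨hU, hUc⟩
    obtain ⟨B, hB, hBc, hBU⟩ := exists_iUnion_eq_closed_subset hU (fun _ => Set.toFinite _) hUc
    exact ⟨B, hB, fun i => δ.not_close_of_disjoint_closed hc (hBc i) (hU i).isClosed_compl
      (Set.disjoint_compl_right_iff_subset.2 (hBU i))⟩
  have hint : ∀ {k : ℕ} {U : Fin k → Set X}, δ.IsCovering U →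
      IsFiniteOpenCover δ.topology fun i => interior (U i) := by
    rintro k U ⟨B, hB, hBU⟩
    refine ⟨fun _ => isOpen_interior, Set.eq_univ_of_univ_subset ?_⟩
    rw [← hB]
    exact Set.iUnion_mono fun i => δ.subset_interior_of_not_close (hBU i)
  have hiff : ∀ n, CoveringDimLE δ.topology n ↔ δ.DimLE n := by
    refine fun n => ⟨fun h k U hU => ?_, fun h k U hU => ?_⟩
    · obtain ⟨m, V, hV, hVU, hm⟩ := h k _ (hint hU)
      exact ⟨m, V, hcov hV, fun j => (hVU j).imp fun i hi => hi.trans interior_subset, hm⟩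
    · obtain ⟨m, V, hV, hVU, hm⟩ := h k U (hcov hU)
      exact ⟨m, _, hint hV, fun j => (hVU j).imp fun i hi => interior_subset.trans hi,
        (coverMultiplicity_mono fun _ => interior_subset).trans hm⟩
  simp only [coveringDim, dim, hiff]

/-- A refinement witnessing `DimLE` may be indexed by the same set as the given covering. -/
theorem DimLE.exists_precise_refinement {X : Type u} {δ : Proximity X} {n : ℕ} (h : δ.DimLE n)
    {k : ℕ} {U : Fin k → Set X} (hU : δ.IsCovering U) :
    ∃ V : Fin k → Set X, δ.IsCovering V ∧ (∀ i, V i ⊆ U i) ∧ coverMultiplicity V ≤ n + 1 := by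
  obtain ⟨m, V, ⟨B, hB, hBV⟩, hVU, hm⟩ := h k U hU
  choose f hf using hVU
  -- Merge the members assigned to the same `U i`. The indices of the merged sets at a point are the
  -- image under `f` of the old ones, so multiplicity does not grow.
  refine ⟨fun i => ⋃ j : {j // f j = i}, V j, ⟨fun i => ⋃ j : {j // f j = i}, B j, ?_, ?_⟩, ?_, ?_⟩
  · refine Set.eq_univ_of_forall fun x => ?_
    obtain ⟨j, hj⟩ := Set.mem_iUnion.1 (hB.symm ▸ Set.mem_univ x)
    exact Set.mem_iUnion.2 ⟨f j, Set.mem_iUnion.2 ⟨⟨j, rfl⟩, hj⟩⟩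
  · intro i hi
    obtain ⟨j, hj⟩ := δ.iUnion_close hi
    exact hBV j (δ.close_mono_right (Set.compl_subset_compl.2
      (Set.subset_iUnion (fun j : {j // f j = i} => V j) j)) hj)
  · rintro i
    refine Set.iUnion_subset fun ⟨j, hj⟩ => ?_
    subst hj
    exact hf j
  · refine coverMultiplicity_le_iff.2 fun x => ?_
    refine le_trans (Set.encard_le_encard ?_)
      ((Set.encard_image_le f {j | x ∈ V j}).trans (coverMultiplicity_le_iff.1 hm x))
    intro i hi
    obtain ⟨⟨j, hj⟩, hx⟩ := Set.mem_iUnion.1 hi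
    exact ⟨j, hx, hj⟩

theorem dimLE_coproduct_iff {I : Type u} {X : I → Type v} [∀ α, Nonempty (X α)]
    (δ : ∀ α, Proximity (X α)) (n : ℕ) :
    (coproduct δ).DimLE n ↔ ∀ α, (δ α).DimLE n := by
  constructor
  · rintro h α k U ⟨B, hB, hBU⟩
    -- `ext A` is `A` on the summand `α` and everything on the others, so farness there is
    -- automatic.
    let ext (A : Set (X α)) : Set (Σ β, X β) := {p | ∀ x : X α, p = ⟨α, x⟩ → x ∈ A}
    have hext : ∀ A, Sigma.mk α ⁻¹' ext A = A := fun A => by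
      ext x
      refine ⟨fun hx => hx x rfl, fun hx y hy => ?_⟩
      rwa [← eq_of_heq (Sigma.mk.inj hy).2]
    have hext' : ∀ A β, β ≠ α → Sigma.mk β ⁻¹' ext A = Set.univ := fun A β hβ =>
      Set.eq_univ_of_forall fun x y hy => absurd (Sigma.mk.inj hy).1 hβ
    have hcov : (coproduct δ).IsCovering fun i => ext (U i) := by
      refine ⟨fun i => ext (B i), Set.eq_univ_of_forall ?_, ?_⟩
      · rintro ⟨β, x⟩
        by_cases hβ : β = α
        · subst hβ
          obtain ⟨i, hi⟩ := Set.mem_iUnion.1 (hB.symm ▸ Set.mem_univ x)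
          exact Set.mem_iUnion.2 ⟨i, (hext (B i)).ge hi⟩
        -- A point of `X α` guarantees that the family has at least one index, as covering the other
        -- summands requires.
        · obtain ⟨y⟩ := (inferInstance : Nonempty (X α))
          obtain ⟨i, -⟩ := Set.mem_iUnion.1 (hB.symm ▸ Set.mem_univ y)
          exact Set.mem_iUnion.2 ⟨i, (hext' (B i) β hβ).ge trivial⟩
      · rintro i ⟨β, hβ⟩
        rw [Set.preimage_compl] at hβ
        by_cases hβα : β = α
        · subst hβα
          rw [hext, hext] at hβ
          exact hBU i hβ
        · rw [hext' (U i) β hβα, Set.compl_univ] at hβ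
          exact Set.not_nonempty_empty ((δ β).nonempty_of_close _ _ hβ).2
    obtain ⟨m, V, ⟨C, hC, hCV⟩, hVU, hm⟩ := h k _ hcov
    refine ⟨m, fun j => Sigma.mk α ⁻¹' V j, ⟨fun j => Sigma.mk α ⁻¹' C j, ?_, ?_⟩, ?_, ?_⟩
    · rw [← Set.preimage_iUnion, hC, Set.preimage_univ]
    · exact fun j hj => hCV j ⟨α, hj⟩
    · exact fun j => (hVU j).imp fun i hi => (Set.preimage_mono hi).trans (hext _).le
    · exact coverMultiplicity_le_iff.2 fun x => coverMultiplicity_le_iff.1 hm ⟨α, x⟩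
  · rintro h k U ⟨B, hB, hBU⟩
    have hcov : ∀ α, (δ α).IsCovering fun i => Sigma.mk α ⁻¹' U i := fun α =>
      ⟨fun i => Sigma.mk α ⁻¹' B i, by rw [← Set.preimage_iUnion, hB, Set.preimage_univ],
        fun i hi => hBU i ⟨α, hi⟩⟩
    choose V hV hVU hm using fun α => (h α).exists_precise_refinement (hcov α)
    choose C hC hCV using hV
    refine ⟨k, fun i => {p | p.2 ∈ V p.1 i}, ⟨fun i => {p | p.2 ∈ C p.1 i}, ?_, ?_⟩, ?_, ?_⟩
    · refine Set.eq_univ_of_forall fun ⟨α, x⟩ => ?_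
      obtain ⟨i, hi⟩ := Set.mem_iUnion.1 ((hC α).symm ▸ Set.mem_univ x)
      exact Set.mem_iUnion.2 ⟨i, hi⟩
    · rintro i ⟨α, hα⟩
      exact hCV α i hα
    · exact fun i => ⟨i, fun p hp => hVU p.1 i hp⟩
    · exact coverMultiplicity_le_iff.2 fun p => coverMultiplicity_le_iff.1 (hm p.1) p.2

theorem dim_coproduct {I : Type u} {X : I → Type v} [∀ α, Nonempty (X α)]
    (δ : ∀ α, Proximity (X α)) : (coproduct δ).dim = ⨆ α, (δ α).dim := by
  have hiff : ∀ n : ℕ, (coproduct δ).dim ≤ n ↔ ⨆ α, (δ α).dim ≤ n := fun n => by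
    simp only [dim_le_iff, dimLE_coproduct_iff, iSup_le_iff]
  have key : ∀ a b : ℕ∞, (∀ n : ℕ, b ≤ n → a ≤ n) → a ≤ b := fun a b h => by
    induction b using ENat.recTopCoe with
    | top => exact le_top
    | coe n => exact h n le_rfl
  exact le_antisymm (key _ _ fun n => (hiff n).2) (key _ _ fun n => (hiff n).1)

end Dimension

/-! ### The Smirnov compactification: compactness and dimension -/

section Smirnov

variable {X : Type u} (δ : Proximity X)

/-- The cluster determined by a grill of pairwise close sets. -/
def clusterOfGrill (G : Set (Set X)) (huniv : Set.univ ∈ G)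
    (hclose : ∀ A ∈ G, ∀ B ∈ G, δ.close A B) (hunion : ∀ A B, A ∪ B ∈ G → A ∈ G ∨ B ∈ G) :
    δ.Cluster where
  sets := {A | ∀ C ∈ G, δ.close A C}
  nonempty := ⟨Set.univ, hclose _ huniv⟩
  close_of_mem := fun A hA B hB => by
    by_contra h
    obtain ⟨E, hE, hE'⟩ := δ.exists_separator _ _ h
    rcases hunion E Eᶜ (by rwa [Set.union_compl_self]) with h | h
    · exact hE (hA E h)
    · exact hE' (δ.symm _ _ (hB _ h))
  mem_of_close := fun A hA C hC => hA C (hclose C hC)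
  mem_or_mem := fun A B hAB => by
    by_contra! hcon
    simp only [Set.mem_ofPred_eq, not_forall] at hcon
    obtain ⟨⟨C, hC, hAC⟩, ⟨D, hD, hBD⟩⟩ := hcon
    obtain ⟨E, hE, hE'⟩ := δ.exists_separator _ _ hAC
    obtain ⟨F, hF, hF'⟩ := δ.exists_separator _ _ hBD
    -- `Eᶜ` and `Fᶜ` are far from members of `G`, hence not in `G`; so `E ∩ F` is in `G`, yet far
    -- from both `A` and `B`.
    have hEF : E ∩ F ∈ G := by
      refine (hunion (E ∩ F) (E ∩ F)ᶜ (by rwa [Set.union_compl_self])).resolve_right fun h => ?_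
      rw [Set.compl_inter] at h
      rcases hunion _ _ h with h | h
      · exact hE' (hclose _ h _ hC)
      · exact hF' (hclose _ h _ hD)
    rcases (δ.union_close _ _ _).1 (hAB _ hEF) with h | h
    · exact hE (δ.close_mono_right Set.inter_subset_left h)
    · exact hF (δ.close_mono_right Set.inter_subset_right h)

/-- An ultrafilter of clusters converges to the cluster generated by the sets that belong to
ultrafilter-almost every cluster. -/
theorem compactSpace_smirnov : @CompactSpace δ.Cluster δ.smirnov.topology := by
  let _ := δ.smirnov.topology
  refine ⟨isCompact_iff_ultrafilter_le_nhds.2 fun 𝒰 _ => ?_⟩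
  let G : Set (Set X) := {C | {τ : δ.Cluster | C ∈ τ.sets} ∈ 𝒰}
  let σ : δ.Cluster := δ.clusterOfGrill G
    (Filter.univ_mem' fun τ => τ.univ_mem)
    (fun A hA B hB => by
      obtain ⟨τ, hτA, hτB⟩ := Ultrafilter.nonempty_of_mem (Filter.inter_mem hA hB)
      exact τ.close_of_mem A hτA B hτB)
    (fun A B hAB => Ultrafilter.union_mem_iff.1
      (Filter.mem_of_superset hAB fun τ hτ => τ.mem_or_mem A B hτ))
  refine ⟨σ, trivial, fun W hW => ?_⟩
  obtain ⟨O, hOW, hO, hσO⟩ := mem_nhds_iff.1 hW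
  refine Filter.mem_of_superset ?_ hOW
  by_contra hO'
  have hOc : Oᶜ ∈ 𝒰 := Ultrafilter.compl_mem_iff_notMem.2 hO'
  suffices h : σ ∈ δ.smirnov.adherence Oᶜ from
    δ.smirnov.isClosed_iff.1 hO.isClosed_compl h hσO
  intro A B hA hB
  -- A set absorbing `Oᶜ` lies in `G`, so it is close to every member of `σ`.
  exact δ.symm _ _ (hB σ rfl A (Filter.mem_of_superset hOc fun τ hτ => hA τ hτ))

/-- The canonical map into the Smirnov compactification. -/
def pointCluster (x : X) : δ.Cluster :=
  δ.clusterOfGrill {A | x ∈ A} trivial (fun _ hA _ hB => δ.close_of_inter _ _ ⟨x, hA, hB⟩)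
    fun _ _ h => h

theorem mem_pointCluster {x : X} {A : Set X} :
    A ∈ (δ.pointCluster x).sets ↔ x ∈ δ.adherence A :=
  ⟨fun h => h {x} rfl, fun h _ hC => δ.close_mono_right (Set.singleton_subset_iff.2 hC) h⟩

/-- A set absorbing `𝒜` has the trace of `𝒜` on `X` in its adherence, and passing to adherences
creates no new closeness. -/
theorem smirnov_close_of_close_preimage {𝒜 ℬ : Set δ.Cluster}
    (h : δ.close (δ.pointCluster ⁻¹' 𝒜) (δ.pointCluster ⁻¹' ℬ)) : δ.smirnov.close 𝒜 ℬ := by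
  intro A B hA hB
  refine δ.close_of_adherence (δ.close_mono_left (fun x hx => ?_)
    (δ.close_mono_right (fun x hx => ?_) h))
  · exact δ.mem_pointCluster.1 (hA _ hx)
  · exact δ.mem_pointCluster.1 (hB _ hx)

theorem smirnov_close_of_preimage_mem {𝒜 : Set δ.Cluster} {σ : δ.Cluster}
    (h : δ.pointCluster ⁻¹' 𝒜 ∈ σ.sets) : δ.smirnov.close 𝒜 {σ} := by
  intro A B hA hB
  refine δ.symm _ _ (δ.close_of_adherence_right (δ.close_mono_right (fun x hx => ?_)
    (σ.close_of_mem _ (hB σ rfl) _ h)))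
  exact δ.mem_pointCluster.1 (hA _ hx)

variable {δ} in
theorem Cluster.exists_mem_of_iUnion_mem (σ : δ.Cluster) {ι : Type*} [Finite ι] {A : ι → Set X}
    (h : ⋃ i, A i ∈ σ.sets) : ∃ i, A i ∈ σ.sets := by
  by_contra! hcon
  have key : ∀ i, ∃ C ∈ σ.sets, ¬ δ.close (A i) C := fun i => by
    by_contra! hC
    exact hcon i (σ.mem_of_close _ hC)
  have : ∀ s : Set ι, s.Finite → ⋃ i ∈ s, A i ∉ σ.sets := by
    intro s hs
    induction s, hs using Set.Finite.induction_on with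
    | empty =>
      intro h
      simp only [Set.mem_empty_iff_false, Set.iUnion_of_empty, Set.iUnion_empty] at h
      exact Set.not_nonempty_empty (δ.nonempty_of_close _ _ (σ.close_of_mem _ h _ h)).1
    | insert _ _ ih =>
      intro h
      rw [Set.biUnion_insert] at h
      exact (σ.mem_or_mem _ _ h).elim (hcon _) ih
  exact this Set.univ Set.finite_univ (by simpa using h)

/-- The clusters that contain no set outside `A`. -/
def smirnovExtension (A : Set X) : Set δ.Cluster := {σ | Aᶜ ∉ σ.sets}

theorem isCovering_smirnovExtension {k : ℕ} {U : Fin k → Set X} (hU : δ.IsCovering U) :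
    δ.smirnov.IsCovering fun i => δ.smirnovExtension (U i) := by
  obtain ⟨B, hB, hBU⟩ := hU
  refine ⟨fun i => {σ | B i ∈ σ.sets}, Set.eq_univ_of_forall fun σ => ?_, fun i h => ?_⟩
  · exact Set.mem_iUnion.2 (σ.exists_mem_of_iUnion_mem (hB ▸ σ.univ_mem))
  · exact hBU i (h _ _ (fun σ hσ => hσ) fun σ hσ => not_not.1 hσ)

theorem isCovering_preimage_pointCluster {k : ℕ} {U : Fin k → Set δ.Cluster}
    (hU : δ.smirnov.IsCovering U) : δ.IsCovering fun i => δ.pointCluster ⁻¹' U i := by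
  obtain ⟨B, hB, hBU⟩ := hU
  exact ⟨fun i => δ.pointCluster ⁻¹' B i,
    by rw [← Set.preimage_iUnion, hB, Set.preimage_univ],
    fun i h => hBU i (δ.smirnov_close_of_close_preimage h)⟩

/-- If `σ` lies in the extensions of several `V i`, their complements cannot cover `X`, since one of
them would then belong to `σ`. So some point of `X` lies in all these `V i`. -/
theorem coverMultiplicity_smirnovExtension_le {k : ℕ} (V : Fin k → Set X) :
    coverMultiplicity (fun i => δ.smirnovExtension (V i)) ≤ coverMultiplicity V := by
  refine coverMultiplicity_le_iff.2 fun σ => ?_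
  let J : Set (Fin k) := {i | σ ∈ δ.smirnovExtension (V i)}
  have hJ : ⋃ i : J, (V i)ᶜ ≠ Set.univ := fun h => by
    obtain ⟨i, hi⟩ := σ.exists_mem_of_iUnion_mem (h ▸ σ.univ_mem)
    exact i.2 hi
  obtain ⟨x, hx⟩ := (Set.ne_univ_iff_exists_notMem _).1 hJ
  refine le_trans (Set.encard_le_encard fun i hi => ?_) (coverMultiplicity_le_iff.1 le_rfl x)
  by_contra hxi
  exact hx (Set.mem_iUnion.2 ⟨⟨i, hi⟩, hxi⟩)

theorem dim_smirnov : δ.smirnov.dim = δ.dim := by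
  have hiff : ∀ n, δ.smirnov.DimLE n ↔ δ.DimLE n := by
    refine fun n => ⟨fun h k U hU => ?_, fun h k U hU => ?_⟩
    · obtain ⟨m, V, hV, hVU, hm⟩ := h k _ (δ.isCovering_smirnovExtension hU)
      refine ⟨m, _, δ.isCovering_preimage_pointCluster hV, fun j => (hVU j).imp
        fun i hi x hx => ?_, ?_⟩
      · by_contra hxU
        exact hi hx (δ.mem_pointCluster.2 (δ.subset_adherence _ hxU))
      · exact coverMultiplicity_le_iff.2 fun x => coverMultiplicity_le_iff.1 hm _
    · obtain ⟨B, hB, hBU⟩ := hU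
      -- Shrink `U i` to `(E i)ᶜ` first: a cluster in the extension of `V j` contains the trace of
      -- some `(E i)ᶜ`, which only makes it close to `(E i)ᶜ`. Since `(E i)ᶜ` is far from `(U i)ᶜ`,
      -- this still puts it in `U i`.
      choose E hE hE' using fun i => δ.smirnov.exists_separator _ _ (hBU i)
      have hW : δ.smirnov.IsCovering fun i => (E i)ᶜ :=
        ⟨B, hB, fun i => by rw [compl_compl]; exact hE i⟩
      obtain ⟨m, V, hV, hVU, hm⟩ := h k _ (δ.isCovering_preimage_pointCluster hW)
      refine ⟨m, _, δ.isCovering_smirnovExtension hV, fun j => (hVU j).imp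
        fun i hi σ hσ => ?_, (δ.coverMultiplicity_smirnovExtension_le V).trans hm⟩
      by_contra hσU
      have hmem := σ.mem_of_superset ((σ.mem_or_compl_mem (V j)).resolve_right hσ) hi
      exact hE' i (δ.smirnov.close_mono_right (Set.singleton_subset_iff.2 hσU)
        (δ.smirnov_close_of_preimage_mem hmem))
  simp only [dim, hiff]

end Smirnov

end Proximity

theorem mainTheorem2 {I : Type u} [Nonempty I] (X : I → Type v) [∀ α, Nonempty (X α)]
    (δ : ∀ α, Proximity (X α)) (hδ : ∀ α, (δ α).IsSeparated) :
    (Proximity.coproduct δ).dim = (Proximity.coproduct fun α => (δ α).smirnov).dim ∧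
    (Proximity.coproduct fun α => (δ α).smirnov).dim = (Proximity.coproduct δ).smirnov.dim ∧
    (Proximity.coproduct δ).smirnov.dim = coveringDim (Proximity.coproduct δ).smirnov.topology ∧
    coveringDim (Proximity.coproduct δ).smirnov.topology =
      ⨆ α, coveringDim (δ α).smirnov.topology ∧
    (⨆ α, coveringDim (δ α).smirnov.topology) = ⨆ α, (δ α).dim ∧
    (⨆ α, (δ α).dim) = ⨆ α, (δ α).smirnov.dim := by
  -- The coproduct formula for the compactifications needs their nonemptiness.
  have hne : ∀ α, Nonempty (δ α).Cluster := fun α => Nonempty.map (δ α).pointCluster inferInstance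
  have hsmirnov : (Proximity.coproduct fun α => (δ α).smirnov).dim = ⨆ α, (δ α).dim := by
    rw [Proximity.dim_coproduct]
    simp only [Proximity.dim_smirnov]
  simp only [Proximity.coveringDim_eq_dim _ (Proximity.compactSpace_smirnov _),
    Proximity.dim_smirnov, Proximity.dim_coproduct δ, hsmirnov, and_self]
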